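/- **Setting.** Let $\mathcal V$ be a finite vocabulary, $K$ a context bound, $d\ge 4$ an embedding dimension, and consider a causal decoder-only Transformer language model with $L$ blocks, block $k$ having $H_k\ge1$ heads of attention dimension $d_{\eta,k}\ge1$ and an MLP with $M_k\ge 1$ layers of arbitrary inner widths. Its trainable parameters form a vector $\boldsymbol\theta\in\mathbb R^p$. For a sequence $\mathrm s=\langle \mathrm s_1,\dots,\mathrm s_T\rangle$ with $1\le T\le K$ put $$\mathbf H^{(0)}(\mathrm s)=\big(\mathbf E_{\mathrm s_1}+\mathbf P_1,\dots,\mathbf E_{\mathrm s_T}+\mathbf P_T\big)^\top,\qquad \mathbf H^{(k)}(\mathrm s)=\mathrm{TB}^{(k)}\big(\mathbf H^{(k-1)}(\mathrm s)\big)\in\mathbb R^{T\times d},$$ where $\mathbf E\in\mathbb R^{|\mathcal V|\times d}$, $\mathbf P\in\mathbb R^{K\times d}$ are trainable and each block is $\mathrm{TB}(\mathbf X)=\mathbf Y+\mathrm{mlp}(\mathrm{LN}_2(\mathbf Y))$, $\mathbf Y=\mathbf X+\mathrm{attn}(\mathrm{LN}_1(\mathbf X))$. Here the layer normalization (row-wise)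 is $\mathrm{LN}(\mathbf x)=\boldsymbol\gamma\odot(\mathbf x-\mu_{\mathbf x}\mathbf 1)/\sqrt{\sigma_{\mathbf x}^2+\varepsilon}+\boldsymbol\beta$, with $\mu_{\mathbf x},\sigma^2_{\mathbf x}$ the mean and variance of the entries of $\mathbf x$ and a fixed $\varepsilon>0$; $\mathrm{attn}(\mathbf X)=[\boldsymbol\eta_1(\mathbf X),\dots,\boldsymbol\eta_H(\mathbf X)]\mathbf W^O$, where $\boldsymbol\eta_h(\mathbf X)=\mathbf A\,\mathbf X\mathbf V^{(h)}$ and $\mathbf A$ is the row-wise softmax of $(\mathbf X\mathbf Q^{(h)})(\mathbf X\mathbf K^{(h)})^\top/\sqrt{d_\eta}$ restricted to the entries $j\le i$ (causal mask); and $\mathrm{mlp}$ (row-wise) is $\mathbf h^{(1)}=\mathbf W^{(1)}\mathbf x+\mathbf b^{(1)}$, $\mathbf h^{(m)}=\mathbf W^{(m)}\sigma(\mathbf h^{(m-1)})+\mathbf b^{(m)}$ for $2\le m\le M$, $\mathrm{mlp}(\mathbf x)=\mathbf h^{(M)}$, with a real-analytic activation $\sigma:\mathbb R\to\mathbb R$.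 The model's prediction is $f(\mathrm s;\boldsymbol\theta)=\mathrm{softmax}\big(\mathbf U\,\mathrm{LN}(\mathbf r(\mathrm s;\boldsymbol\theta))\big)$, where $\mathbf r(\mathrm s;\boldsymbol\theta)$ is the last row of $\mathbf H^{(L)}(\mathrm s)$. All of $\mathbf E,\mathbf P,\mathbf U$, the matrices and vectors $\mathbf Q,\mathbf K,\mathbf V,\mathbf W^O,\mathbf W,\mathbf b$ and the pairs $(\boldsymbol\gamma,\boldsymbol\beta)$ of every layer normalization are separate trainable parameters. **Training.** Let $\boldsymbol\theta_0$ be a random vector in $\mathbb R^p$ whose law is absolutely continuous with respect to Lebesgue measure. Let $(\mathrm s_i,\mathbf p_i)_{i\in I}$ be a finite family of samples, $\mathrm s_i$ a non-empty sequence over $\mathcal V$ of length at most $K$ and $\mathbf p_i$ a probability vector on $\mathcal V$; let $N\ge0$, let $\alpha_0,\dots,\alpha_{N-1}\in(0,1)$ be step sizes, and let $\mathcal B_0,\dots,\mathcal B_{N-1}\subseteq I$ be non-empty batches, which may be chosen arbitrarily (deterministically, randomly or adversarially). Put, for $n<N$, $$\boldsymbol\theta_{n+1}=\boldsymbol\theta_n-\alpha_n\nabla\Big(\frac1{|\mathcal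 B_n|}\sum_{i\in\mathcal B_n}\mathrm{CrossEntropy}\big(f(\mathrm s_i;\cdot),\mathbf p_i\big)\Big)(\boldsymbol\theta_n),\qquad \mathrm{CrossEntropy}(\mathbf q,\mathbf p)=-\sum_{v}\mathbf p_v\log \mathbf q_v .$$ **Claim.** Fix a layer $\ell\in\{1,\dots,L\}$, a position $t\in\{1,\dots,K\}$ and a prefix $\pi\in\mathcal V^{t-1}$. Let $F(v)=F(v;\pi,t)\in\mathbb R^d$ be row $t$ of $\mathbf H^{(\ell)}(\pi\oplus v)$ computed with the parameters $\boldsymbol\theta_N$, where $\pi\oplus v$ is $\pi$ followed by the token $v$. Then $$\Pr\big[\exists\, v\ne v'\in\mathcal V:\ F(v;\pi,t)=F(v';\pi,t)\big]=0,$$ equivalently, $F(\cdot;\pi,t)$ is almost surely injective on $\mathcal V$. Moreover, if $|\mathcal V|\ge2$, the separation margin $\Delta_{\pi,t}:=\min_{v\neq v'\in\mathcal V}\|F(v;\pi,t)-F(v';\pi,t)\|_2$ satisfies $\Pr[\Delta_{\pi,t}>0]=1$. -/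

import Mathlib

namespace CausalTLM

noncomputable section

/-- Dimensions of one transformer block: number `H` of heads, attention dimension `d_η`,
number `M` of MLP layers, and the widths of the inner MLP layers
(`hidden m` is the width `d_m` for `0 < m < M`). -/
structure BlockArch where
  heads : ℕ
  headDim : ℕ
  mlpLayers : ℕ
  hidden : ℕ → ℕ

/-- Dimensions of a transformer language model: context bound `K`, embedding dimension `d`,
number `L` of blocks, and the dimensions of every block. -/
structure Arch where
  context : ℕ
  dim : ℕ
  layers : ℕ
  block : Fin layers → BlockArch

/-- Widths `d_0, …, d_M` of the MLP of a block, with `d_0 = d_M = d`. -/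
def mlpWidth (d : ℕ) (b : BlockArch) (m : ℕ) : ℕ :=
  if m = 0 ∨ m = b.mlpLayers then d else b.hidden m

theorem mlpWidth_zero (d : ℕ) (b : BlockArch) : mlpWidth d b 0 = d := by
  simp [mlpWidth]

theorem mlpWidth_last (d : ℕ) (b : BlockArch) : mlpWidth d b b.mlpLayers = d := by
  simp [mlpWidth]

/-- The scalar trainable parameters of one block. The MLP parameters `W^{(m)}`, `b^{(m)}`,
`1 ≤ m ≤ M`, are indexed by `m - 1 : Fin M`. -/
inductive BlockParam (d : ℕ) (b : BlockArch) : Type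
  | query (h : Fin b.heads) (i : Fin d) (j : Fin b.headDim)
  | key (h : Fin b.heads) (i : Fin d) (j : Fin b.headDim)
  | value (h : Fin b.heads) (i : Fin d) (j : Fin b.headDim)
  | outProj (h : Fin b.heads) (i : Fin b.headDim) (j : Fin d)
  | scaleAttn (i : Fin d)
  | shiftAttn (i : Fin d)
  | scaleMlp (i : Fin d)
  | shiftMlp (i : Fin d)
  | weight (m : Fin b.mlpLayers) (i : Fin (mlpWidth d b (m + 1))) (j : Fin (mlpWidth d b m))
  | bias (m : Fin b.mlpLayers) (i : Fin (mlpWidth d b (m + 1)))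
  deriving Fintype

/-- The scalar trainable parameters of the whole model: token embedding `E`, positional
embedding `P`, the blocks, the unembedding matrix `U` and its layer normalization. -/
inductive Param (V : Type*) (A : Arch)
  | tokenEmb (v : V) (i : Fin A.dim)
  | posEmb (k : Fin A.context) (i : Fin A.dim)
  | block (l : Fin A.layers) (q : BlockParam A.dim (A.block l))
  | unemb (v : V) (i : Fin A.dim)
  | scaleOut (i : Fin A.dim)
  | shiftOut (i : Fin A.dim)
  deriving Fintype

/-- The parameter space `ℝ^p`, with its Euclidean structure and Lebesgue measure. -/
abbrev ParamSpace (V : Type*) [Fintype V] (A : Arch) : Type _ :=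
  EuclideanSpace ℝ (Param V A)

/-! ### The modules -/

/-- Layer normalization of a vector. -/
def layerNorm {d : ℕ} (ε : ℝ) (γ β x : Fin d → ℝ) : Fin d → ℝ :=
  let mean : ℝ := (∑ i, x i) / d
  let var : ℝ := (∑ i, (x i - mean) ^ 2) / d
  fun i => γ i * ((x i - mean) / Real.sqrt (var + ε)) + β i

/-- Layer normalization of every row of a matrix. -/
def layerNormRows {T d : ℕ} (ε : ℝ) (γ β : Fin d → ℝ) (X : Matrix (Fin T) (Fin d) ℝ) :
    Matrix (Fin T) (Fin d) ℝ :=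
  Matrix.of fun t => layerNorm ε γ β (X t)

/-- Row normalization: every row is divided by its sum. -/
def rowNormalize {T : ℕ} (Y : Matrix (Fin T) (Fin T) ℝ) : Matrix (Fin T) (Fin T) ℝ :=
  Matrix.of fun i j => Y i j / ∑ k, Y i k

/-- Causal attention weights of a logit matrix `Z`: the entries `exp (Z i j)` with `j ≤ i` are
kept, those with `j > i` are replaced by `0`, and every row is normalized. -/
def causalSoftmax {T : ℕ} (Z : Matrix (Fin T) (Fin T) ℝ) : Matrix (Fin T) (Fin T) ℝ :=
  rowNormalize (Matrix.of fun i j => if j ≤ i then Real.exp (Z i j) else 0)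

/-- A causal self-attention head with query, key and value matrices `Q`, `R`, `W`. -/
def causalAttention {T d e : ℕ} (Q R W : Matrix (Fin d) (Fin e) ℝ)
    (X : Matrix (Fin T) (Fin d) ℝ) : Matrix (Fin T) (Fin e) ℝ :=
  causalSoftmax ((1 / Real.sqrt e) • ((X * Q) * (X * R).transpose)) * (X * W)

/-- Multi-head causal self-attention: the heads are concatenated (columns indexed by pairs
`(h, j)`) and multiplied by the output projection. -/
def multiHead {T d : ℕ} {b : BlockArch} (w : BlockParam d b → ℝ)
    (X : Matrix (Fin T) (Fin d) ℝ) : Matrix (Fin T) (Fin d) ℝ :=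
  let concat : Matrix (Fin T) (Fin b.heads × Fin b.headDim) ℝ :=
    Matrix.of fun t q =>
      causalAttention (Matrix.of fun i j => w (.query q.1 i j))
        (Matrix.of fun i j => w (.key q.1 i j))
        (Matrix.of fun i j => w (.value q.1 i j)) X t q.2
  let proj : Matrix (Fin b.heads × Fin b.headDim) (Fin d) ℝ :=
    Matrix.of fun q j => w (.outProj q.1 q.2 j)
  concat * proj

/-- The vectors `h^{(m)}` of the MLP, starting from `h^{(0)} = x`; the activation is applied to
`h^{(m)}` for `m ≥ 1` only. -/
def mlpState {d : ℕ} {b : BlockArch} (σ : ℝ → ℝ) (w : BlockParam d b → ℝ) (x : Fin d → ℝ) :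
    (m : ℕ) → m ≤ b.mlpLayers → Fin (mlpWidth d b m) → ℝ
  | 0, _ => fun i => x (Fin.cast (mlpWidth_zero d b) i)
  | m + 1, hm => fun i =>
      (∑ j, w (.weight ⟨m, hm⟩ i j) *
        (if m = 0 then mlpState σ w x m (Nat.le_of_succ_le hm) j
          else σ (mlpState σ w x m (Nat.le_of_succ_le hm) j)))
      + w (.bias ⟨m, hm⟩ i)

/-- The MLP with `M` layers, `x ↦ h^{(M)}`. -/
def mlp {d : ℕ} {b : BlockArch} (σ : ℝ → ℝ) (w : BlockParam d b → ℝ) (x : Fin d → ℝ) :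
    Fin d → ℝ :=
  fun i => mlpState σ w x b.mlpLayers le_rfl (Fin.cast (mlpWidth_last d b).symm i)

/-- A pre-normalization residual transformer block. -/
def transformerBlock {T d : ℕ} {b : BlockArch} (σ : ℝ → ℝ) (ε : ℝ) (w : BlockParam d b → ℝ)
    (X : Matrix (Fin T) (Fin d) ℝ) : Matrix (Fin T) (Fin d) ℝ :=
  let Y := X + multiHead w
    (layerNormRows ε (fun i => w (.scaleAttn i)) (fun i => w (.shiftAttn i)) X)
  Y + Matrix.of fun t => mlp σ w
    (layerNormRows ε (fun i => w (.scaleMlp i)) (fun i => w (.shiftMlp i)) Y t)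

/-! ### The language model -/

/-- The softmax of a vector. -/
def softmax {V : Type*} [Fintype V] (z : V → ℝ) : V → ℝ :=
  fun v => Real.exp (z v) / ∑ u, Real.exp (z u)

variable {V : Type*} [Fintype V] {A : Arch}

/-- Token plus positional embedding of a sequence of length `T ≤ K`. -/
def embedding (θ : ParamSpace V A) {T : ℕ} (hT : T ≤ A.context) (s : Fin T → V) :
    Matrix (Fin T) (Fin A.dim) ℝ :=
  Matrix.of fun t i => θ (.tokenEmb (s t) i) + θ (.posEmb (Fin.castLE hT t) i)

/-- The layer outputs `H^{(0)}, …, H^{(L)}` on a sequence of length `T ≤ K`. -/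
def layerOutput (σ : ℝ → ℝ) (ε : ℝ) (θ : ParamSpace V A) {T : ℕ} (hT : T ≤ A.context)
    (s : Fin T → V) (l : Fin (A.layers + 1)) : Matrix (Fin T) (Fin A.dim) ℝ :=
  Fin.induction (motive := fun _ => Matrix (Fin T) (Fin A.dim) ℝ) (embedding θ hT s)
    (fun k X => transformerBlock σ ε (fun q => θ (.block k q)) X) l

/-- Prompts: non-empty sequences of length at most `K`. -/
structure Prompt (V : Type*) (K : ℕ) where
  length : ℕ
  pos : 0 < length
  le : length ≤ K
  tok : Fin length → V

/-- The last-token representation: the last row of the output of the last block. -/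
def lastToken (σ : ℝ → ℝ) (ε : ℝ) (θ : ParamSpace V A) (s : Prompt V A.context) :
    Fin A.dim → ℝ :=
  layerOutput σ ε θ s.le s.tok (Fin.last A.layers) ⟨s.length - 1, Nat.sub_lt s.pos one_pos⟩

/-- Next-token prediction: the unembedding layer applied to the last-token representation. -/
def predict (σ : ℝ → ℝ) (ε : ℝ) (θ : ParamSpace V A) (s : Prompt V A.context) : V → ℝ :=
  softmax fun v => ∑ i, θ (.unemb v i) *
    layerNorm ε (fun i => θ (.scaleOut i)) (fun i => θ (.shiftOut i)) (lastToken σ ε θ s) i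

/-! ### Training -/

/-- A training sample: a prompt and a target distribution on the vocabulary. -/
structure Sample (V : Type*) [Fintype V] (K : ℕ) where
  prompt : Prompt V K
  target : V → ℝ
  target_mem : target ∈ stdSimplex ℝ V

/-- Cross-entropy of a prediction `f` relative to the target `p`. -/
def crossEntropy (f p : V → ℝ) : ℝ := -∑ v, p v * Real.log (f v)

/-- The cross-entropy loss on one sample. -/
def sampleLoss (σ : ℝ → ℝ) (ε : ℝ) (z : Sample V A.context) (θ : ParamSpace V A) : ℝ :=
  crossEntropy (predict σ ε θ z.prompt) z.target

/-- The average loss over a mini-batch `B` of a data set `D`. -/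
def batchLoss {ι : Type*} (σ : ℝ → ℝ) (ε : ℝ) (D : ι → Sample V A.context) (B : Finset ι)
    (θ : ParamSpace V A) : ℝ :=
  (∑ i ∈ B, sampleLoss σ ε (D i) θ) / B.card

/-- Mini-batch gradient descent: `n`-th iterate from `θ₀`, with step sizes `η` and batches `B`. -/
def gdIterate {ι : Type*} (σ : ℝ → ℝ) (ε : ℝ) (D : ι → Sample V A.context) (η : ℕ → ℝ)
    (B : ℕ → Finset ι) (θ₀ : ParamSpace V A) : ℕ → ParamSpace V A
  | 0 => θ₀
  | n + 1 => gdIterate σ ε D η B θ₀ n -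
      η n • gradient (batchLoss σ ε D (B n)) (gdIterate σ ε D η B θ₀ n)

/-! ### The one-step map -/

/-- The one-step map `v ↦ h_t(π ⊕ v)` at the output of block `l`. Positions and blocks are
counted from `0` here: `t : Fin K` stands for the position `t + 1`, so a prefix has length `t`
and the row at that position is the last row; `l : Fin L` stands for the layer `l + 1`. -/
def oneStep (σ : ℝ → ℝ) (ε : ℝ) (θ : ParamSpace V A) (l : Fin A.layers) (t : Fin A.context)
    (π : Fin t → V) (v : V) : EuclideanSpace ℝ (Fin A.dim) :=
  WithLp.toLp 2
    (layerOutput σ ε θ (T := t + 1) t.isLt (Fin.snoc (α := fun _ => V) π v) l.succ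
      (Fin.last (t : ℕ)))

open Classical in
theorem offDiag_univ_nonempty (V : Type*) [Fintype V] [Nontrivial V] :
    (Finset.univ : Finset V).offDiag.Nonempty := by
  obtain ⟨v, v', h⟩ := exists_pair_ne V
  exact ⟨(v, v'), Finset.mem_offDiag.mpr ⟨Finset.mem_univ v, Finset.mem_univ v', h⟩⟩

open Classical in
/-- The separation margin `min_{v ≠ v'} ‖F v - F v'‖₂` of a map on a vocabulary with at least
two elements. -/
def margin [Nontrivial V] {d : ℕ} (F : V → EuclideanSpace ℝ (Fin d)) : ℝ :=
  (Finset.univ : Finset V).offDiag.inf' (offDiag_univ_nonempty V) fun q => ‖F q.1 - F q.2‖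

end

end CausalTLM

/-! Everything is real-analytic in the parameters: `σ` is analytic, `ε > 0` keeps the normalizations
smooth, and softmax denominators are positive. An analytic function that is nonzero at one point
vanishes only on a null set, so each genericity claim reduces to exhibiting one good parameter.

Collisions: if all block parameters vanish, every block is the identity, and a suitable token
embedding separates two given tokens. Hence the collision set is null
(`volume_oneStep_collision_eq_zero`).

Training: a gradient step pulls null sets back to null sets as soon as its Jacobian determinant is
not identically zero, since off the critical set it is a local diffeomorphism. The good point is the
origin: there the loss has Hessian form at most `‖v‖ ^ 2` (`exists_hasDerivAt_deriv_batchLoss`), so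
for `0 < α < 1` the derivative `id - α • Hess` is injective. Iterating gives
`volume_preimage_gdIterate_eq_zero`. Batches may be adversarial because only finitely many batch
sequences of length `N` exist, and a finite union of null sets is null. -/

namespace CausalTLM

open MeasureTheory Topology Set
open scoped ContDiff Pointwise

/-! ### Null sets: zeros of analytic functions and preimages under smooth maps. -/

section NullSets

variable {E : Type*} [NormedAddCommGroup E] [NormedSpace ℝ E] [FiniteDimensional ℝ E]
  [MeasurableSpace E] [BorelSpace E] (μ : Measure E) [μ.IsAddHaarMeasure]

/-- The zeros of a real-analytic function of one variable that is not identically zero form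
a null set. -/
theorem volume_zeros_eq_zero_of_contDiff_omega {g : ℝ → ℝ} (hg : ContDiff ℝ ω g) {x : ℝ}
    (hx : g x ≠ 0) : volume {s | g s = 0} = 0 := by
  have h := (contDiff_omega_iff_analyticOnNhd.mp hg).preimage_zero_mem_codiscrete hx
  have hae : g ⁻¹' {0}ᶜ ∈ ae (volume.restrict univ) :=
    ae_restrict_le_codiscreteWithin (U := (univ : Set ℝ)) MeasurableSet.univ h
  rw [Measure.restrict_univ, mem_ae_iff] at hae
  refine measure_mono_null (fun s hs => ?_) hae
  simpa using hs

/-- The zero set of a real-analytic function on a finite-dimensional space that is not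
identically zero is a null set. -/
theorem measure_zeros_eq_zero_of_contDiff_omega {f : E → ℝ} (hf : ContDiff ℝ ω f) {x₀ : E}
    (hx₀ : f x₀ ≠ 0) : μ {x | f x = 0} = 0 := by
  have hmeas : MeasurableSet {p : E × ℝ | ¬ f (x₀ + p.2 • p.1) = 0} := by
    have hc : Continuous fun p : E × ℝ => f (x₀ + p.2 • p.1) :=
      hf.continuous.comp (by fun_prop)
    exact (hc.measurable (measurableSet_singleton 0)).compl
  -- On each line through `x₀` the restriction is nonzero at `s = 0`. Fubini then gives a single `s
  -- ≠ 0` that works for almost every `x`, and the zero set of `f` is a dilated translate of the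
  -- resulting null set.
  have hrays : ∀ᵐ x ∂μ, ∀ᵐ s : ℝ, ¬ f (x₀ + s • x) = 0 := by
    refine Filter.Eventually.of_forall fun x => ?_
    have hg : ContDiff ℝ ω fun s : ℝ => f (x₀ + s • x) := hf.comp (by fun_prop)
    rw [ae_iff]
    simpa using volume_zeros_eq_zero_of_contDiff_omega hg (x := 0) (by simpa using hx₀)
  have hscal : ∀ᵐ s : ℝ, ∀ᵐ x ∂μ, ¬ f (x₀ + s • x) = 0 := (Measure.ae_ae_comm hmeas).mp hrays
  have hne : ∀ᵐ s : ℝ, s ≠ 0 := by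
    rw [ae_iff]
    simp
  obtain ⟨s, hs, hs0⟩ := (hscal.and hne).exists
  rw [ae_iff] at hs
  simp only [not_not] at hs
  have himage : {x | f x = 0} = (fun y => x₀ + y) '' (s • {x | f (x₀ + s • x) = 0}) := by
    ext x
    simp only [mem_ofPred_eq, mem_image, mem_smul_set]
    constructor
    · intro hx
      refine ⟨x - x₀, ⟨s⁻¹ • (x - x₀), ?_, ?_⟩, by abel⟩
      · rw [smul_inv_smul₀ hs0]
        simpa using hx
      · rw [smul_inv_smul₀ hs0]
    · rintro ⟨y, ⟨z, hz, rfl⟩, rfl⟩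
      exact hz
  rw [himage, image_add_left, measure_preimage_add, Measure.addHaar_smul, hs, mul_zero]

/-- A `C^1` map whose critical points form a null set pulls null sets back to null sets. -/
theorem measure_preimage_eq_zero_of_contDiff {φ : E → E} (hφ : ContDiff ℝ 1 φ)
    (hcrit : μ {x | (fderiv ℝ φ x).det = 0} = 0) {N : Set E} (hN : μ N = 0) :
    μ (φ ⁻¹' N) = 0 := by
  suffices h : μ (φ ⁻¹' N \ {x | (fderiv ℝ φ x).det = 0}) = 0 by
    refine measure_mono_null ?_ (measure_union_null h hcrit)
    intro x hx
    by_cases hd : (fderiv ℝ φ x).det = 0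
    · exact Or.inr hd
    · exact Or.inl ⟨hx, hd⟩
  -- Near a regular point the set is the image, under a differentiable local inverse, of a subset of
  -- `N`; differentiable maps between equal dimensions preserve null sets.
  refine measure_null_of_locally_null _ fun x hx => ?_
  have hder : HasFDerivAt φ
      ((fderiv ℝ φ x).toContinuousLinearEquivOfDetNeZero hx.2 : E →L[ℝ] E) x :=
    (hφ.differentiable one_ne_zero x).hasFDerivAt
  let e := hφ.contDiffAt.toOpenPartialHomeomorph φ hder one_ne_zero
  have hxe : x ∈ e.source := ContDiffAt.mem_toOpenPartialHomeomorph_source _ hder one_ne_zero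
  refine ⟨e.source ∩ (φ ⁻¹' N \ {x | (fderiv ℝ φ x).det = 0}),
    Filter.inter_mem (mem_nhdsWithin_of_mem_nhds (e.open_source.mem_nhds hxe)) self_mem_nhdsWithin, ?_⟩
  set S := e.source ∩ (φ ⁻¹' N \ {x | (fderiv ℝ φ x).det = 0}) with hS
  have hnull : μ (φ '' S) = 0 := measure_mono_null (by rintro _ ⟨y, hy, rfl⟩; exact hy.2.1) hN
  have hdiff : DifferentiableOn ℝ e.symm (φ '' S) := by
    rintro _ ⟨y, hy, rfl⟩
    have hleft : e.symm (φ y) = y := e.left_inv hy.1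
    have htarget : φ y ∈ e.target := e.map_source hy.1
    have hy' : HasFDerivAt e
        ((fderiv ℝ φ y).toContinuousLinearEquivOfDetNeZero hy.2.2 : E →L[ℝ] E)
        (e.symm (φ y)) := by
      rw [hleft]
      exact (hφ.differentiable one_ne_zero y).hasFDerivAt
    exact (e.hasFDerivAt_symm htarget hy').differentiableAt.differentiableWithinAt
  refine measure_mono_null ?_
    (addHaar_image_eq_zero_of_differentiableOn_of_addHaar_eq_zero μ hdiff hnull)
  intro y hy
  exact ⟨φ y, ⟨y, hy, rfl⟩, e.left_inv hy.1⟩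

end NullSets

/-! ### Gradient steps of analytic functions. -/

section GradientStep

variable {E : Type*} [NormedAddCommGroup E] [InnerProductSpace ℝ E] [FiniteDimensional ℝ E]

theorem contDiff_gradient {f : E → ℝ} (hf : ContDiff ℝ ω f) : ContDiff ℝ ω (gradient f) := by
  have h : ContDiff ℝ ω (fderiv ℝ f) := hf.fderiv_right (by simp)
  exact (InnerProductSpace.toDual ℝ E).symm.toContinuousLinearEquiv.contDiff.comp h

/-- If along every line through `x` the second derivative `c` of `f` satisfies `α c < ‖v‖²`, the
derivative of the gradient step `y ↦ y - α ∇f(y)` at `x` is injective. -/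
theorem det_fderiv_gradient_step_ne_zero {f : E → ℝ} (hf : ContDiff ℝ ω f) (α : ℝ) (x : E)
    (h : ∀ v : E, v ≠ 0 → ∃ c : ℝ, α * c < ‖v‖ ^ 2 ∧
      HasDerivAt (deriv fun s : ℝ => f (x + s • v)) c 0) :
    (fderiv ℝ (fun y => y - α • gradient f y) x).det ≠ 0 := by
  have hgrad := (contDiff_gradient hf).differentiable (by simp)
  intro hdet
  obtain ⟨v, hv0, hv⟩ : ∃ v : E, v ≠ 0 ∧
      fderiv ℝ (fun y => y - α • gradient f y) x v = 0 := by
    have := LinearMap.bot_lt_ker_of_det_eq_zero (f := (fderiv ℝ (fun y => y - α • gradient f y) x :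
      E →ₗ[ℝ] E)) hdet
    obtain ⟨v, hv, hv0⟩ := Submodule.exists_mem_ne_zero_of_ne_bot this.ne'
    exact ⟨v, hv0, by simpa using hv⟩
  obtain ⟨c, hc, hderiv⟩ := h v hv0
  have hline : ∀ s : ℝ, HasDerivAt (fun s : ℝ => x + s • v) v s := fun s => by
    simpa using ((hasDerivAt_id s).smul_const v).const_add x
  have hfirst : (deriv fun s : ℝ => f (x + s • v)) = fun s => inner ℝ v (gradient f (x + s • v)) := by
    funext s
    have hd : DifferentiableAt ℝ f (x + s • v) := hf.differentiable (by simp) _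
    have := hd.hasGradientAt.hasFDerivAt.comp_hasDerivAt s (hline s)
    rw [real_inner_comm]
    simpa [Function.comp_def] using this.deriv
  have hsecond : HasDerivAt (fun s : ℝ => inner ℝ v (gradient f (x + s • v)))
      (inner ℝ v (fderiv ℝ (gradient f) x v)) 0 := by
    have h1 : HasFDerivAt (gradient f) (fderiv ℝ (gradient f) x) (x + (0 : ℝ) • v) := by
      simpa using (hgrad x).hasFDerivAt
    have h2 := h1.comp_hasDerivAt (0 : ℝ) (hline 0)
    simpa using (hasDerivAt_const (0 : ℝ) v).inner ℝ h2
  rw [hfirst] at hderiv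
  have hcval := hderiv.unique hsecond
  have hstep : HasFDerivAt (fun y => y - α • gradient f y)
      (ContinuousLinearMap.id ℝ E - α • fderiv ℝ (gradient f) x) x :=
    (hasFDerivAt_id x).sub ((hgrad x).hasFDerivAt.const_smul α)
  rw [hstep.fderiv] at hv
  -- A kernel vector of the step's derivative is fixed by `α` times the Hessian, so pairing with `v`
  -- forces `α * c = ‖v‖ ^ 2`.
  have hv' : α • fderiv ℝ (gradient f) x v = v := by
    simpa [sub_eq_zero, eq_comm (a := v)] using hv
  have : α * c = ‖v‖ ^ 2 := by
    rw [hcval, ← inner_smul_right, hv', real_inner_self_eq_norm_sq]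
  exact hc.ne this

variable [MeasurableSpace E] [BorelSpace E] (μ : Measure E) [μ.IsAddHaarMeasure]

/-- In a fixed basis the determinant is a polynomial in the matrix entries, which are analytic. -/
theorem contDiff_det_fderiv {E : Type*} [NormedAddCommGroup E] [NormedSpace ℝ E]
    [FiniteDimensional ℝ E] {φ : E → E} (hφ : ContDiff ℝ ω φ) :
    ContDiff ℝ ω fun x => (fderiv ℝ φ x).det := by
  let b := Module.finBasis ℝ E
  have hdet : ∀ x, (fderiv ℝ φ x).det =
      Matrix.det (Matrix.of fun i j => b.repr (fderiv ℝ φ x (b j)) i) := by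
    intro x
    rw [ContinuousLinearMap.det, ← LinearMap.det_toMatrix b]
    congr 1
    ext i j
    simp [LinearMap.toMatrix_apply]
  have hder : ContDiff ℝ ω (fderiv ℝ φ) := hφ.fderiv_right (by simp)
  simp only [hdet, Matrix.det_apply', Matrix.of_apply]
  refine ContDiff.sum fun p _ => contDiff_const.mul (contDiff_prod fun i _ => ?_)
  have : ContDiff ℝ ω fun x => fderiv ℝ φ x (b i) := hder.clm_apply contDiff_const
  exact ((b.coord (p i)).toContinuousLinearMap).contDiff.comp this

/-- A Hessian bound at the single point `x` suffices: the Jacobian determinant is analytic, so one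
nonzero value makes the critical set null. -/
theorem measure_preimage_gradient_step_eq_zero {f : E → ℝ} (hf : ContDiff ℝ ω f) (α : ℝ) (x : E)
    (h : ∀ v : E, v ≠ 0 → ∃ c : ℝ, α * c < ‖v‖ ^ 2 ∧
      HasDerivAt (deriv fun s : ℝ => f (x + s • v)) c 0) {N : Set E} (hN : μ N = 0) :
    μ ((fun y => y - α • gradient f y) ⁻¹' N) = 0 := by
  have hstep : ContDiff ℝ ω fun y => y - α • gradient f y :=
    contDiff_id.sub ((contDiff_gradient hf).const_smul α)
  refine measure_preimage_eq_zero_of_contDiff μ (hstep.of_le (by simp)) ?_ hN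
  exact measure_zeros_eq_zero_of_contDiff_omega μ (contDiff_det_fderiv hstep)
    (det_fderiv_gradient_step_ne_zero hf α x h)

end GradientStep

/-! ### Analyticity of the modules in the parameters. -/

section Smoothness

variable {E : Type*} [NormedAddCommGroup E] [NormedSpace ℝ E]

theorem contDiff_layerNorm {d : ℕ} {ε : ℝ} (hε : 0 < ε) {γ β x : E → Fin d → ℝ}
    (hγ : ContDiff ℝ ω γ) (hβ : ContDiff ℝ ω β) (hx : ContDiff ℝ ω x) :
    ContDiff ℝ ω fun θ => layerNorm ε (γ θ) (β θ) (x θ) := by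
  rw [contDiff_pi] at *
  intro i
  have hmean : ContDiff ℝ ω fun θ => (∑ i, x θ i) / d := (ContDiff.sum fun i _ => hx i).div_const _
  have hvar : ContDiff ℝ ω fun θ => (∑ i, (x θ i - (∑ i, x θ i) / d) ^ 2) / d :=
    (ContDiff.sum fun i _ => ((hx i).sub hmean).pow 2).div_const _
  have hpos : ∀ θ, 0 < (∑ i, (x θ i - (∑ i, x θ i) / d) ^ 2) / d + ε := fun θ => by positivity
  exact ((hγ i).mul (((hx i).sub hmean).div
    ((hvar.add contDiff_const).sqrt fun θ => (hpos θ).ne')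
    fun θ => (Real.sqrt_pos.mpr (hpos θ)).ne')).add (hβ i)

theorem contDiff_causalAttention {T d e : ℕ} {Q R W : E → Matrix (Fin d) (Fin e) ℝ}
    {X : E → Matrix (Fin T) (Fin d) ℝ} (hQ : ∀ i j, ContDiff ℝ ω fun θ => Q θ i j)
    (hR : ∀ i j, ContDiff ℝ ω fun θ => R θ i j) (hW : ∀ i j, ContDiff ℝ ω fun θ => W θ i j)
    (hX : ∀ i j, ContDiff ℝ ω fun θ => X θ i j) (t : Fin T) (j : Fin e) :
    ContDiff ℝ ω fun θ => causalAttention (Q θ) (R θ) (W θ) (X θ) t j := by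
  have hmul : ∀ {M : E → Matrix (Fin d) (Fin e) ℝ}, (∀ i j, ContDiff ℝ ω fun θ => M θ i j) →
      ∀ i j, ContDiff ℝ ω fun θ => (X θ * M θ) i j := by
    intro M hM i j
    simp only [Matrix.mul_apply]
    exact ContDiff.sum fun k _ => (hX i k).mul (hM k j)
  have hexp : ∀ i j, ContDiff ℝ ω fun θ => if j ≤ i then
      Real.exp (((1 / Real.sqrt e) • ((X θ * Q θ) * (X θ * R θ).transpose)) i j) else 0 := by
    intro i j
    split_ifs
    · refine ContDiff.exp ?_
      simp only [Matrix.smul_apply, Matrix.mul_apply (M := X _ * Q _), Matrix.transpose_apply]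
      exact (ContDiff.sum fun k _ => (hmul hQ i k).mul (hmul hR j k)).const_smul _
    · exact contDiff_const
  unfold causalAttention
  simp only [causalSoftmax, rowNormalize]
  simp_rw [Matrix.mul_apply (N := X _ * W _), Matrix.of_apply]
  refine ContDiff.sum fun k _ => ContDiff.mul ?_ (hmul hW k j)
  refine (hexp t k).div (ContDiff.sum fun k _ => hexp t k) fun θ => ?_
  -- The diagonal entry survives the causal mask, so no row sum vanishes.
  refine (Finset.sum_pos' (fun i _ => ?_) ⟨t, Finset.mem_univ t, ?_⟩).ne'
  · split_ifs <;> positivity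
  · rw [if_pos le_rfl]
    positivity

theorem contDiff_mlpState {d : ℕ} {b : BlockArch} {σ : ℝ → ℝ} (hσ : ContDiff ℝ ω σ)
    {w : E → BlockParam d b → ℝ} (hw : ∀ q, ContDiff ℝ ω fun θ => w θ q)
    {x : E → Fin d → ℝ} (hx : ∀ i, ContDiff ℝ ω fun θ => x θ i) (m : ℕ) (hm : m ≤ b.mlpLayers) :
    ∀ i, ContDiff ℝ ω fun θ => mlpState σ (w θ) (x θ) m hm i := by
  induction m with
  | zero => exact fun i => hx _
  | succ m ih =>
    intro i
    simp only [mlpState]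
    refine (ContDiff.sum fun j _ => (hw _).mul ?_).add (hw _)
    split_ifs
    · exact ih _ j
    · exact hσ.comp (ih _ j)

theorem contDiff_transformerBlock {T d : ℕ} {b : BlockArch} {σ : ℝ → ℝ} (hσ : ContDiff ℝ ω σ)
    {ε : ℝ} (hε : 0 < ε) {w : E → BlockParam d b → ℝ} (hw : ∀ q, ContDiff ℝ ω fun θ => w θ q)
    {X : E → Matrix (Fin T) (Fin d) ℝ} (hX : ∀ i j, ContDiff ℝ ω fun θ => X θ i j)
    (t : Fin T) (j : Fin d) :
    ContDiff ℝ ω fun θ => transformerBlock σ ε (w θ) (X θ) t j := by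
  have hnorm : ∀ {g s : Fin d → BlockParam d b} {Z : E → Matrix (Fin T) (Fin d) ℝ},
      (∀ i j, ContDiff ℝ ω fun θ => Z θ i j) → ∀ i j, ContDiff ℝ ω fun θ =>
        layerNormRows ε (fun i => w θ (g i)) (fun i => w θ (s i)) (Z θ) i j := by
    intro g s Z hZ i
    exact contDiff_pi.mp (contDiff_layerNorm hε (contDiff_pi.mpr fun i => hw (g i))
      (contDiff_pi.mpr fun i => hw (s i)) (contDiff_pi.mpr (hZ i)))
  have hY : ∀ t j, ContDiff ℝ ω fun θ => (X θ + multiHead (w θ) (layerNormRows ε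
      (fun i => w θ (.scaleAttn i)) (fun i => w θ (.shiftAttn i)) (X θ))) t j := by
    intro t j
    simp only [Matrix.add_apply, multiHead, Matrix.mul_apply, Matrix.of_apply]
    refine (hX t j).add (ContDiff.sum fun q _ => ContDiff.mul ?_ (hw _))
    exact contDiff_causalAttention (fun _ _ => hw _) (fun _ _ => hw _) (fun _ _ => hw _)
      (hnorm hX) t q.2
  exact (hY t j).add (contDiff_mlpState hσ hw (hnorm hY t) _ _ _)

variable {V : Type*} [Fintype V] {A : Arch}

theorem contDiff_param (q : Param V A) : ContDiff ℝ ω fun θ : ParamSpace V A => θ q :=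
  (EuclideanSpace.proj (𝕜 := ℝ) q).contDiff

theorem contDiff_layerOutput {σ : ℝ → ℝ} (hσ : ContDiff ℝ ω σ) {ε : ℝ} (hε : 0 < ε)
    {T : ℕ} (hT : T ≤ A.context) (s : Fin T → V) (l : Fin (A.layers + 1)) :
    ∀ t i, ContDiff ℝ ω fun θ : ParamSpace V A => layerOutput σ ε θ hT s l t i := by
  induction l using Fin.induction with
  | zero => exact fun t i => (contDiff_param _).add (contDiff_param _)
  | succ l ih =>
    intro t i
    simp only [layerOutput, Fin.induction_succ]
    exact contDiff_transformerBlock hσ hε (fun q => contDiff_param _) ih t i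

end Smoothness

/-! ### Softmax cross-entropy as log-sum-exp. -/

section Softmax

variable {V : Type*} [Fintype V]

/-- The cross-entropy of a softmax is the log-sum-exp of the logits minus their mean. -/
theorem crossEntropy_softmax [Nonempty V] (z p : V → ℝ) (hp : p ∈ stdSimplex ℝ V) :
    crossEntropy (softmax z) p = Real.log (∑ u, Real.exp (z u)) - ∑ v, p v * z v := by
  have hpos : 0 < ∑ u, Real.exp (z u) :=
    Finset.sum_pos (fun _ _ => Real.exp_pos _) Finset.univ_nonempty
  have hlog : ∀ v, Real.log (softmax z v) = z v - Real.log (∑ u, Real.exp (z u)) := fun v => by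
    rw [softmax, Real.log_div (Real.exp_pos _).ne' hpos.ne', Real.log_exp]
  simp only [crossEntropy, hlog, mul_sub, Finset.sum_sub_distrib, ← Finset.sum_mul, hp.2]
  ring

theorem contDiff_log_sum_exp [Nonempty V] {E : Type*} [NormedAddCommGroup E] [NormedSpace ℝ E]
    {z : E → V → ℝ} (hz : ∀ v, ContDiff ℝ ω fun θ => z θ v) :
    ContDiff ℝ ω fun θ => Real.log (∑ u, Real.exp (z θ u)) :=
  (ContDiff.sum fun u _ => (hz u).exp).log fun _ =>
    (Finset.sum_pos (fun _ _ => Real.exp_pos _) Finset.univ_nonempty).ne'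

end Softmax

/-! ### Analyticity of the loss. -/

section Loss

variable {V : Type*} [Fintype V] {A : Arch}

/-- The logits of the next-token prediction. -/
noncomputable def logits (σ : ℝ → ℝ) (ε : ℝ) (θ : ParamSpace V A) (s : Prompt V A.context) :
    V → ℝ :=
  fun v => ∑ i, θ (.unemb v i) *
    layerNorm ε (fun i => θ (.scaleOut i)) (fun i => θ (.shiftOut i)) (lastToken σ ε θ s) i

theorem contDiff_lastToken {σ : ℝ → ℝ} (hσ : ContDiff ℝ ω σ) {ε : ℝ} (hε : 0 < ε)
    (s : Prompt V A.context) (i : Fin A.dim) :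
    ContDiff ℝ ω fun θ : ParamSpace V A => lastToken σ ε θ s i :=
  contDiff_layerOutput hσ hε s.le s.tok _ _ i

theorem contDiff_logits {σ : ℝ → ℝ} (hσ : ContDiff ℝ ω σ) {ε : ℝ} (hε : 0 < ε)
    (s : Prompt V A.context) (v : V) :
    ContDiff ℝ ω fun θ : ParamSpace V A => logits σ ε θ s v :=
  ContDiff.sum fun i _ => (contDiff_param _).mul <| contDiff_pi.mp (contDiff_layerNorm hε
    (contDiff_pi.mpr fun _ => contDiff_param _) (contDiff_pi.mpr fun _ => contDiff_param _)
    (contDiff_pi.mpr (contDiff_lastToken hσ hε s))) i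

theorem sampleLoss_eq {σ : ℝ → ℝ} {ε : ℝ} (z : Sample V A.context) (θ : ParamSpace V A) :
    sampleLoss σ ε z θ = Real.log (∑ u, Real.exp (logits σ ε θ z.prompt u)) -
      ∑ v, z.target v * logits σ ε θ z.prompt v := by
  have : Nonempty V := ⟨z.prompt.tok ⟨0, z.prompt.pos⟩⟩
  exact crossEntropy_softmax (logits σ ε θ z.prompt) z.target z.target_mem

theorem contDiff_sampleLoss {σ : ℝ → ℝ} (hσ : ContDiff ℝ ω σ) {ε : ℝ} (hε : 0 < ε)
    (z : Sample V A.context) : ContDiff ℝ ω (sampleLoss (A := A) σ ε z) := by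
  have : Nonempty V := ⟨z.prompt.tok ⟨0, z.prompt.pos⟩⟩
  rw [funext (sampleLoss_eq z)]
  exact (contDiff_log_sum_exp (contDiff_logits hσ hε z.prompt)).sub
    (ContDiff.sum fun v _ => contDiff_const.mul (contDiff_logits hσ hε z.prompt v))

theorem contDiff_batchLoss {σ : ℝ → ℝ} (hσ : ContDiff ℝ ω σ) {ε : ℝ} (hε : 0 < ε)
    {ι : Type*} (D : ι → Sample V A.context) (B : Finset ι) :
    ContDiff ℝ ω (batchLoss (A := A) σ ε D B) :=
  (ContDiff.sum fun i _ => contDiff_sampleLoss hσ hε (D i)).div_const _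

end Loss

/-! ### The network with vanishing block parameters. -/

section Identity

variable {V : Type*} [Fintype V] {A : Arch}

/-- Only the residual path survives: the output projection and the last affine layer of the MLP are
zero. An MLP with no layers would be the identity instead of zero, hence `hb`. -/
theorem transformerBlock_of_zero {T d : ℕ} {b : BlockArch} (hb : 1 ≤ b.mlpLayers) (σ : ℝ → ℝ)
    (ε : ℝ) {w : BlockParam d b → ℝ} (hw : ∀ q, w q = 0) (X : Matrix (Fin T) (Fin d) ℝ) :
    transformerBlock σ ε w X = X := by
  have hmlp : ∀ x : Fin d → ℝ, mlp σ w x = 0 := by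
    have hstate : ∀ (x : Fin d → ℝ) (m : ℕ) (hm : m ≤ b.mlpLayers), 1 ≤ m →
        ∀ i, mlpState σ w x m hm i = 0 := by
      rintro x (_ | m) hm h1 i
      · omega
      · simp [mlpState, hw]
    intro x
    funext i
    exact hstate x _ _ hb _
  ext t i
  simp [transformerBlock, multiHead, hmlp, hw, Matrix.mul_apply]

/-- With vanishing block parameters every layer outputs the embedding. -/
theorem layerOutput_of_block_eq_zero (hmlp : ∀ l, 1 ≤ (A.block l).mlpLayers) (σ : ℝ → ℝ) (ε : ℝ)
    {θ : ParamSpace V A} (hθ : ∀ l q, θ (.block l q) = 0) {T : ℕ} (hT : T ≤ A.context)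
    (s : Fin T → V) (l : Fin (A.layers + 1)) :
    layerOutput σ ε θ hT s l = embedding θ hT s := by
  induction l using Fin.induction with
  | zero => rfl
  | succ l ih =>
    simp only [layerOutput, Fin.induction_succ] at ih ⊢
    rw [ih, transformerBlock_of_zero (hmlp l) σ ε (hθ l)]

theorem lastToken_zero (hmlp : ∀ l, 1 ≤ (A.block l).mlpLayers) (σ : ℝ → ℝ) (ε : ℝ)
    (s : Prompt V A.context) : lastToken σ ε (0 : ParamSpace V A) s = 0 := by
  funext i
  rw [lastToken, layerOutput_of_block_eq_zero hmlp σ ε (by simp)]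
  simp [embedding]

end Identity

/-! ### The Hessian of the loss at the origin. -/

section SecondDerivative

/-- Second derivative at `0` of a softmax cross-entropy whose logits vanish to second order. -/
theorem hasDerivAt_deriv_log_sum_exp_sub {V : Type*} [Fintype V] [Nonempty V] (p : V → ℝ)
    {w : V → ℝ → ℝ} (hw : ∀ u, ContDiff ℝ ω (w u)) :
    HasDerivAt (deriv fun s : ℝ => Real.log (∑ u, Real.exp (s ^ 2 * w u s)) -
        ∑ u, p u * (s ^ 2 * w u s))
      (2 * ∑ u, ((Fintype.card V : ℝ)⁻¹ - p u) * w u 0) 0 := by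
  have hpos : ∀ s : ℝ, 0 < ∑ u, Real.exp (s ^ 2 * w u s) := fun s =>
    Finset.sum_pos (fun u _ => Real.exp_pos _) Finset.univ_nonempty
  -- The first derivative is `s * k s`, so its derivative at `0` is `k 0` by continuity of `k`
  -- alone.
  let k : ℝ → ℝ := fun s =>
    (∑ u, Real.exp (s ^ 2 * w u s) * (2 * w u s + s * deriv (w u) s)) /
      (∑ u, Real.exp (s ^ 2 * w u s)) - ∑ u, p u * (2 * w u s + s * deriv (w u) s)
  have hderiv : (deriv fun s : ℝ => Real.log (∑ u, Real.exp (s ^ 2 * w u s)) -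
        ∑ u, p u * (s ^ 2 * w u s)) = fun s => s * k s := by
    funext s
    have hz : ∀ u, HasDerivAt (fun s : ℝ => s ^ 2 * w u s)
        (s * (2 * w u s + s * deriv (w u) s)) s := fun u => by
      have h1 : HasDerivAt (w u) (deriv (w u) s) s :=
        ((hw u).differentiable (by simp) s).hasDerivAt
      refine ((hasDerivAt_pow 2 s).fun_mul h1).congr_deriv ?_
      norm_num
      ring
    have hsum : HasDerivAt (fun s : ℝ => ∑ u, Real.exp (s ^ 2 * w u s))
        (∑ u, Real.exp (s ^ 2 * w u s) * (s * (2 * w u s + s * deriv (w u) s))) s :=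
      HasDerivAt.fun_sum fun u _ => (hz u).exp
    have hlin : HasDerivAt (fun s : ℝ => ∑ u, p u * (s ^ 2 * w u s))
        (∑ u, p u * (s * (2 * w u s + s * deriv (w u) s))) s :=
      HasDerivAt.fun_sum fun u _ => (hz u).const_mul (p u)
    refine ((hsum.log (hpos s).ne').sub hlin).deriv.trans ?_
    simp only [k, mul_sub, ← mul_div_assoc, Finset.mul_sum]
    simp only [mul_left_comm s]
  have hcont : Continuous k := by
    have h0 : ∀ u, Continuous (w u) := fun u => (hw u).continuous
    have h1 : ∀ u, Continuous (deriv (w u)) := fun u =>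
      (hw u).continuous_deriv (by simp)
    refine Continuous.sub (Continuous.div ?_ ?_ fun s => (hpos s).ne') ?_ <;> fun_prop
  have hk0 : k 0 = 2 * ∑ u, ((Fintype.card V : ℝ)⁻¹ - p u) * w u 0 := by
    simp only [k, ne_eq, OfNat.ofNat_ne_zero, not_false_eq_true, zero_pow, zero_mul, Real.exp_zero,
      one_mul, add_zero, Finset.sum_const, Finset.card_univ, nsmul_eq_mul, mul_one, sub_mul,
      Finset.sum_sub_distrib, mul_sub, ← Finset.mul_sum, mul_left_comm _ (2 : ℝ)]
    rw [div_eq_inv_mul]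
    ring
  rw [hderiv, ← hk0, hasDerivAt_iff_tendsto_slope]
  refine (hcont.tendsto 0 |>.mono_left nhdsWithin_le_nhds).congr' ?_
  filter_upwards [self_mem_nhdsWithin] with s hs
  have hs0 : s ≠ 0 := hs
  simp [slope_def_field, hs0]

variable {V : Type*} [Fintype V] {A : Arch}

/-- The unembedding and the final shift occupy disjoint sets of coordinates of `v`. -/
theorem sum_sq_unemb_add_sum_sq_shiftOut_le (v : ParamSpace V A) :
    ∑ i, (v (.shiftOut i) ^ 2 + ∑ u, v (.unemb u i) ^ 2) ≤ ‖v‖ ^ 2 := by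
  classical
  let e : Fin A.dim ⊕ (V × Fin A.dim) ↪ Param V A :=
    ⟨Sum.elim Param.shiftOut fun q => Param.unemb q.1 q.2, by
      rintro (i | ⟨u, i⟩) (j | ⟨u', j⟩) h <;> simp_all⟩
  have h : ∑ x, v (e x) ^ 2 ≤ ∑ q, v q ^ 2 := by
    rw [← Finset.sum_map Finset.univ e fun q => v q ^ 2]
    exact Finset.sum_le_sum_of_subset_of_nonneg (Finset.subset_univ _) fun q _ _ => sq_nonneg _
  rw [EuclideanSpace.real_norm_sq_eq, Finset.sum_add_distrib, Finset.sum_comm]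
  rw [Fintype.sum_sum_type, Fintype.sum_prod_type] at h
  exact h

theorem sum_sq_uniform_sub_le_one [Nonempty V] {p : V → ℝ} (hp : p ∈ stdSimplex ℝ V) :
    ∑ u, ((Fintype.card V : ℝ)⁻¹ - p u) ^ 2 ≤ 1 := by
  have hcard : (0 : ℝ) < Fintype.card V := by exact_mod_cast Fintype.card_pos
  have hsq : ∑ u, p u ^ 2 ≤ 1 := by
    rw [← hp.2]
    refine Finset.sum_le_sum fun u _ => ?_
    have h1 : p u ≤ 1 := by
      rw [← hp.2]
      exact Finset.single_le_sum (fun u _ => hp.1 u) (Finset.mem_univ u)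
    nlinarith [hp.1 u]
  have : ∑ u, ((Fintype.card V : ℝ)⁻¹ - p u) ^ 2 = ∑ u, p u ^ 2 - (Fintype.card V : ℝ)⁻¹ := by
    simp only [sub_sq, Finset.sum_add_distrib, Finset.sum_sub_distrib, ← Finset.mul_sum, hp.2,
      Finset.sum_const, Finset.card_univ, nsmul_eq_mul]
    field_simp
    ring
  rw [this]
  have := inv_pos.mpr hcard
  linarith

/-- For each coordinate `i`, Cauchy–Schwarz over the vocabulary is followed by `2ab ≤ a² + b²`. The
resulting constant `1` is what makes every step size below `1` admissible. -/
theorem two_mul_sum_uniform_sub_mul_logits_le [Nonempty V] {p : V → ℝ} (hp : p ∈ stdSimplex ℝ V)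
    (v : ParamSpace V A) :
    2 * ∑ u, ((Fintype.card V : ℝ)⁻¹ - p u) * ∑ i, v (.unemb u i) * v (.shiftOut i) ≤
      ‖v‖ ^ 2 := by
  refine le_trans ?_ (sum_sq_unemb_add_sum_sq_shiftOut_le v)
  simp only [Finset.mul_sum]
  rw [Finset.sum_comm]
  refine Finset.sum_le_sum fun i _ => ?_
  have hcs := Finset.sum_mul_sq_le_sq_mul_sq Finset.univ
    (fun u => (Fintype.card V : ℝ)⁻¹ - p u) fun u => v (.unemb u i)
  have hU : 0 ≤ ∑ u, v (.unemb u i) ^ 2 := Finset.sum_nonneg fun u _ => sq_nonneg _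
  have hq := sum_sq_uniform_sub_le_one hp
  have hrw : ∑ u, 2 * (((Fintype.card V : ℝ)⁻¹ - p u) * (v (.unemb u i) * v (.shiftOut i))) =
      2 * v (.shiftOut i) * ∑ u, ((Fintype.card V : ℝ)⁻¹ - p u) * v (.unemb u i) := by
    rw [Finset.mul_sum]
    exact Finset.sum_congr rfl fun u _ => by ring
  rw [hrw]
  nlinarith [sq_nonneg (v (.shiftOut i) -
    ∑ u, ((Fintype.card V : ℝ)⁻¹ - p u) * v (.unemb u i)), mul_le_mul_of_nonneg_right hq hU]

/-- Along the ray `s • v` the unembedding contributes one factor `s`, and the scale and shift of the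
final normalization another, so the logits are `s ^ 2 * w u s`. At `s = 0` the last-token vector is
zero and only the shift is left in `w`, so the inner layers do not enter the second derivative. -/
theorem exists_hasDerivAt_deriv_sampleLoss (hmlp : ∀ l, 1 ≤ (A.block l).mlpLayers) {σ : ℝ → ℝ}
    (hσ : ContDiff ℝ ω σ) {ε : ℝ} (hε : 0 < ε) (z : Sample V A.context) (v : ParamSpace V A) :
    ∃ c ≤ ‖v‖ ^ 2, HasDerivAt (deriv fun s : ℝ => sampleLoss σ ε z (s • v)) c 0 := by
  have : Nonempty V := ⟨z.prompt.tok ⟨0, z.prompt.pos⟩⟩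
  let w : V → ℝ → ℝ := fun u s => ∑ i, v (.unemb u i) *
    layerNorm ε (fun i => v (.scaleOut i)) (fun i => v (.shiftOut i))
      (lastToken σ ε (s • v) z.prompt) i
  have hw : ∀ u, ContDiff ℝ ω (w u) := fun u =>
    ContDiff.sum fun i _ => contDiff_const.mul <| contDiff_pi.mp (contDiff_layerNorm hε
      contDiff_const contDiff_const (contDiff_pi.mpr fun i =>
        (contDiff_lastToken hσ hε z.prompt i).comp (contDiff_id.smul contDiff_const))) i
  have hw0 : ∀ u, w u 0 = ∑ i, v (.unemb u i) * v (.shiftOut i) := fun u => by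
    simp [w, lastToken_zero hmlp, layerNorm]
  have hloss : (fun s : ℝ => sampleLoss σ ε z (s • v)) = fun s =>
      Real.log (∑ u, Real.exp (s ^ 2 * w u s)) - ∑ u, z.target u * (s ^ 2 * w u s) := by
    have hlogits : ∀ s u, logits σ ε (s • v) z.prompt u = s ^ 2 * w u s := fun s u => by
      simp only [logits, w, Finset.mul_sum]
      refine Finset.sum_congr rfl fun i _ => ?_
      simp only [layerNorm, PiLp.smul_apply, smul_eq_mul]
      ring
    funext s
    simp only [sampleLoss_eq, hlogits]
  refine ⟨_, two_mul_sum_uniform_sub_mul_logits_le z.target_mem v, ?_⟩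
  simp only [← hw0]
  rw [hloss]
  exact hasDerivAt_deriv_log_sum_exp_sub z.target hw

theorem exists_hasDerivAt_deriv_batchLoss (hmlp : ∀ l, 1 ≤ (A.block l).mlpLayers) {σ : ℝ → ℝ}
    (hσ : ContDiff ℝ ω σ) {ε : ℝ} (hε : 0 < ε) {ι : Type*} (D : ι → Sample V A.context)
    {B : Finset ι} (hB : B.Nonempty) (v : ParamSpace V A) :
    ∃ c ≤ ‖v‖ ^ 2, HasDerivAt (deriv fun s : ℝ => batchLoss σ ε D B (s • v)) c 0 := by
  choose c hc hderiv using fun i => exists_hasDerivAt_deriv_sampleLoss hmlp hσ hε (D i) v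
  refine ⟨(∑ i ∈ B, c i) / B.card, ?_, ?_⟩
  · rw [div_le_iff₀ (by exact_mod_cast hB.card_pos), mul_comm, ← nsmul_eq_mul]
    exact Finset.sum_le_card_nsmul B c _ fun i _ => hc i
  · have hline : ∀ i, Differentiable ℝ fun s : ℝ => sampleLoss σ ε (D i) (s • v) := fun i =>
      ((contDiff_sampleLoss hσ hε (D i)).differentiable (by simp)).comp
        (differentiable_id.smul_const v)
    have hd : (deriv fun s : ℝ => batchLoss σ ε D B (s • v)) = fun s =>
        (∑ i ∈ B, deriv (fun s : ℝ => sampleLoss σ ε (D i) (s • v)) s) / B.card := by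
      funext s
      exact ((HasDerivAt.fun_sum fun i _ => (hline i s).hasDerivAt).div_const _).deriv
    rw [hd]
    exact (HasDerivAt.fun_sum fun i _ => hderiv i).div_const _

end SecondDerivative

/-! ### Null sets along training, and the collision set. -/

section Training

variable {V : Type*} [Fintype V] {A : Arch}

/-- Gradient descent pulls Lebesgue null sets back to Lebesgue null sets. -/
theorem volume_preimage_gdIterate_eq_zero (hmlp : ∀ l, 1 ≤ (A.block l).mlpLayers) {σ : ℝ → ℝ}
    (hσ : ContDiff ℝ ω σ) {ε : ℝ} (hε : 0 < ε) {ι : Type*} (D : ι → Sample V A.context)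
    {η : ℕ → ℝ} {B : ℕ → Finset ι} (N : ℕ) (hη : ∀ n < N, η n ∈ Ioo (0 : ℝ) 1)
    (hB : ∀ n < N, (B n).Nonempty) {S : Set (ParamSpace V A)} (hS : volume S = 0) :
    volume {θ | gdIterate σ ε D η B θ N ∈ S} = 0 := by
  induction N generalizing S with
  | zero => exact hS
  | succ n ih =>
    -- The last step is peeled off: `S` is replaced by its preimage under that step, again a null
    -- set.
    refine ih (fun k hk => hη k (by omega)) (fun k hk => hB k (by omega))
      (S := (fun y => y - η n • gradient (batchLoss σ ε D (B n)) y) ⁻¹' S) ?_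
    refine measure_preimage_gradient_step_eq_zero volume (contDiff_batchLoss hσ hε D (B n)) (η n) 0
      (fun v hv => ?_) hS
    obtain ⟨c, hc, hderiv⟩ :=
      exists_hasDerivAt_deriv_batchLoss hmlp hσ hε D (hB n (by omega)) v
    refine ⟨c, ?_, by simpa using hderiv⟩
    obtain ⟨h0, h1⟩ := hη n (by omega)
    have hv : 0 < ‖v‖ ^ 2 := by positivity
    -- As `c` may be negative, both bounds on the step size are used: `η n * c ≤ η n * ‖v‖ ^ 2 < ‖v‖
    -- ^ 2`.
    nlinarith

/-- This reduces arbitrary batch sequences to the finitely many of length `N`. -/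
theorem gdIterate_congr {ι : Type*} (σ : ℝ → ℝ) (ε : ℝ) (D : ι → Sample V A.context) (η : ℕ → ℝ)
    {B B' : ℕ → Finset ι} (θ : ParamSpace V A) {N : ℕ} (h : ∀ n < N, B n = B' n) :
    gdIterate σ ε D η B θ N = gdIterate σ ε D η B' θ N := by
  induction N with
  | zero => rfl
  | succ n ih =>
    simp only [gdIterate, ih fun k hk => h k (by omega), h n (by omega)]

/-- The parameters at which the one-step map is not injective form a null set. -/
theorem volume_oneStep_collision_eq_zero (hdim : 0 < A.dim)
    (hmlp : ∀ l, 1 ≤ (A.block l).mlpLayers) {σ : ℝ → ℝ} (hσ : ContDiff ℝ ω σ) {ε : ℝ} (hε : 0 < ε)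
    (l : Fin A.layers) (t : Fin A.context) (π : Fin t → V) :
    volume {θ : ParamSpace V A | ∃ v v' : V, v ≠ v' ∧
      oneStep σ ε θ l t π v = oneStep σ ε θ l t π v'} = 0 := by
  classical
  have hpair : ∀ v v' : V, v ≠ v' → volume {θ : ParamSpace V A |
      oneStep σ ε θ l t π v = oneStep σ ε θ l t π v'} = 0 := by
    intro v v' hv
    let i₀ : Fin A.dim := ⟨0, hdim⟩
    let f : ParamSpace V A → ℝ := fun θ => oneStep σ ε θ l t π v i₀ - oneStep σ ε θ l t π v' i₀
    have hcoord : ∀ u, ContDiff ℝ ω fun θ : ParamSpace V A => oneStep σ ε θ l t π u i₀ := fun u => by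
      simp only [oneStep]
      exact contDiff_layerOutput hσ hε _ _ l.succ (Fin.last t) i₀
    have hf : ContDiff ℝ ω f := (hcoord v).sub (hcoord v')
    -- All blocks vanish at `θ₁`, so the rows are plain embeddings and differ by `1` in coordinate
    -- `i₀`.
    let θ₁ : ParamSpace V A := EuclideanSpace.single (.tokenEmb v i₀) 1
    have hθ₁ : f θ₁ ≠ 0 := by
      have hblock : ∀ l q, θ₁ (.block l q) = 0 := fun l q => by simp [θ₁]
      simp only [f, oneStep, layerOutput_of_block_eq_zero hmlp σ ε hblock, embedding,
        Matrix.of_apply, Fin.snoc_last]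
      simp [θ₁, hv.symm]
    refine measure_mono_null ?_ (measure_zeros_eq_zero_of_contDiff_omega volume hf hθ₁)
    intro θ hθ
    have hθ' : oneStep σ ε θ l t π v = oneStep σ ε θ l t π v' := hθ
    simp [f, hθ']
  have hunion : {θ : ParamSpace V A | ∃ v v' : V, v ≠ v' ∧
      oneStep σ ε θ l t π v = oneStep σ ε θ l t π v'} = ⋃ (v : V) (v' : V) (_ : v ≠ v'),
        {θ | oneStep σ ε θ l t π v = oneStep σ ε θ l t π v'} := by
    ext θ
    simp
  rw [hunion]
  simp only [measure_iUnion_null_iff]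
  exact hpair

end Training

end CausalTLM

/-! ### Random initialization and arbitrary batches. -/

theorem mainTheorem6 {V : Type*} [Fintype V] (A : CausalTLM.Arch)
    (hdim : 4 ≤ A.dim)
    (hheads : ∀ l, 1 ≤ (A.block l).heads)
    (hheadDim : ∀ l, 1 ≤ (A.block l).headDim)
    (hmlp : ∀ l, 1 ≤ (A.block l).mlpLayers)
    (σ : ℝ → ℝ) (hσ : AnalyticOnNhd ℝ σ Set.univ)
    (ε : ℝ) (hε : 0 < ε)
    {Ω : Type*} [MeasurableSpace Ω] (P : MeasureTheory.Measure Ω)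
    [MeasureTheory.IsProbabilityMeasure P]
    (θ₀ : Ω → CausalTLM.ParamSpace V A) (hθ₀ : AEMeasurable θ₀ P)
    (hac : (P.map θ₀).AbsolutelyContinuous MeasureTheory.volume)
    {ι : Type*} [Finite ι] (D : ι → CausalTLM.Sample V A.context)
    (N : ℕ) (η : ℕ → ℝ) (hη : ∀ n < N, η n ∈ Set.Ioo (0 : ℝ) 1)
    (B : Ω → ℕ → Finset ι) (hB : ∀ ω, ∀ n < N, (B ω n).Nonempty)
    (l : Fin A.layers) (t : Fin A.context) (π : Fin t → V) :
    P {ω | ∃ v v' : V, v ≠ v' ∧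
        CausalTLM.oneStep σ ε (CausalTLM.gdIterate σ ε D η (B ω) (θ₀ ω) N) l t π v =
          CausalTLM.oneStep σ ε (CausalTLM.gdIterate σ ε D η (B ω) (θ₀ ω) N) l t π v'} = 0 ∧
      (∀ᵐ ω ∂P, Function.Injective
        (CausalTLM.oneStep σ ε (CausalTLM.gdIterate σ ε D η (B ω) (θ₀ ω) N) l t π)) ∧
      (∀ _ : Nontrivial V, ∀ᵐ ω ∂P, 0 < CausalTLM.margin
        (CausalTLM.oneStep σ ε (CausalTLM.gdIterate σ ε D η (B ω) (θ₀ ω) N) l t π)) := by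
  have hσ' := contDiff_omega_iff_analyticOnNhd.mpr hσ
  let Z : Set (CausalTLM.ParamSpace V A) := {θ | ∃ v v' : V, v ≠ v' ∧
    CausalTLM.oneStep σ ε θ l t π v = CausalTLM.oneStep σ ε θ l t π v'}
  have hZ : MeasureTheory.volume Z = 0 :=
    CausalTLM.volume_oneStep_collision_eq_zero (by omega) hmlp hσ' hε l t π
  -- The value `∅` from index `N` on is never read by the first `N` steps.
  let extend : (Fin N → Finset ι) → ℕ → Finset ι := fun b n => if h : n < N then b ⟨n, h⟩ else ∅
  have hbatch : ∀ b : Fin N → Finset ι, ∀ᵐ ω ∂P, (∀ n, (b n).Nonempty) →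
      CausalTLM.gdIterate σ ε D η (extend b) (θ₀ ω) N ∉ Z := by
    intro b
    by_cases hb : ∀ n, (b n).Nonempty
    · have hnull := hac (CausalTLM.volume_preimage_gdIterate_eq_zero hmlp hσ' hε D (η := η)
        (B := extend b) N hη (fun n hn => by simpa [extend, hn] using hb ⟨n, hn⟩) hZ)
      filter_upwards [MeasureTheory.ae_of_ae_map hθ₀ (MeasureTheory.measure_eq_zero_iff_ae_notMem.mp hnull)] with ω hω _
      exact hω
    · exact Filter.Eventually.of_forall fun ω h => absurd h hb
  have hgood : ∀ᵐ ω ∂P, CausalTLM.gdIterate σ ε D η (B ω) (θ₀ ω) N ∉ Z := by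
    -- The exceptional null sets are united over all deterministic batch sequences before the one
    -- realized at `ω` is selected, so `B` may depend on `ω` in any way, even non-measurably.
    filter_upwards [MeasureTheory.ae_all_iff.mpr hbatch] with ω hω
    have := hω (fun n => B ω n) fun n => hB ω n n.2
    rwa [CausalTLM.gdIterate_congr σ ε D η (B' := B ω) (θ₀ ω)
      fun n hn => by simp [extend, hn]] at this
  have hinj : ∀ᵐ ω ∂P, Function.Injective
      (CausalTLM.oneStep σ ε (CausalTLM.gdIterate σ ε D η (B ω) (θ₀ ω) N) l t π) := by
    filter_upwards [hgood] with ω hω v v' h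
    by_contra hne
    exact hω ⟨v, v', hne, h⟩
  refine ⟨MeasureTheory.measure_eq_zero_iff_ae_notMem.mpr hgood, hinj, fun _ => ?_⟩
  filter_upwards [hinj] with ω hω
  rw [CausalTLM.margin, Finset.lt_inf'_iff]
  intro q hq
  rw [norm_pos_iff, sub_ne_zero]
  exact fun h => (Finset.mem_offDiag.mp hq).2.2 (hω h)
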